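/- Let $n \ge 2$. The repeated balls-into-bins process is the following: $n$ balls are initially placed in $n$ bins, and at every round one ball is chosen from each non-empty bin, according to an arbitrary strategy (FIFO, random, etc.; the choice may be randomized and may depend on the whole past of the process, but not on the future), and all the chosen balls are simultaneously re-assigned, independently, each to one of the $n$ bins chosen uniformly at random. Let $M^{(t)}$ be the maximum number of balls in one bin after $t$ rounds, where $M^{(0)}$ refers to the initial configuration. All constants below are real numbers that do not depend on $n$, on the strategy or on the initial configuration. 1. (Stability) For all constants $c, A, L, \gamma$ there is a constant $K$ such that, for every $n\ge 2$, every strategy and every initial configuration with $M^{(0)} \le L\log n$, for every integer $0\le T \le A n^c$, $$\Pr\left[\, M^{(t)} \le K \log n \ \text{ for all } 0 \le t \le T \,\right] \ \ge\ 1 - n^{-\gamma}.$$ 2. (Convergence) For every constant $\gamma$ there are constants $K$ and $C\in\mathbb N$ such that, for every $n \ge 2$, every strategy and every initial configuration, $$\Pr\left[\, M^{(t)} \le K \log n \ \text{ for some } 0 \le t \le C n \,\right] \ \ge\ 1 - n^{-\gamma}.$$ In other words, calling a configuration legitimate if its maximum load is $O(\log n)$: from any legitimate configuration the process takes on only legitimate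 configurations for any polynomial number of rounds, with high probability, and from any configuration it reaches a legitimate one within $O(n)$ rounds, with high probability; that is, the process is self-stabilizing. -/

import Mathlib

/-- A configuration of `n` labelled balls in `n` bins: `x i` is the bin that holds ball `i`. -/
abbrev Config (n : ℕ) : Type := Fin n → Fin n

/-- The number of balls in bin `b`. -/
def load {n : ℕ} (x : Config n) (b : Fin n) : ℕ :=
  (Finset.univ.filter fun i => x i = b).card

/-- The maximum number of balls inside one bin. -/
def maxLoad {n : ℕ} (x : Config n) : ℕ :=
  Finset.univ.sup (load x)

/-- The configuration has maximum load at most `K * log n`. A family of configurations (one or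
more for every `n`) is legitimate when this holds with one constant `K` for all of them. -/
def IsLegitimate {n : ℕ} (K : ℝ) (x : Config n) : Prop :=
  (maxLoad x : ℝ) ≤ K * Real.log n

/-- The set `s` of balls contains exactly one ball of every non-empty bin. -/
def IsSelection {n : ℕ} (x : Config n) (s : Finset (Fin n)) : Prop :=
  ∀ b : Fin n, (∃ i, x i = b) → ∃! i, i ∈ s ∧ x i = b

/-- The history of the process up to some round: the initial configuration and then, for every
round, the set of balls that were extracted and the configuration after the round. -/
inductive Run (n : ℕ) : Type
  | start (x : Config n) : Run n
  | round (r : Run n) (s : Finset (Fin n)) (y : Config n) : Run n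

/-- The current configuration, at the end of the history. -/
def Run.current {n : ℕ} : Run n → Config n
  | .start x => x
  | .round _ _ y => y

/-- All the configurations taken on during the history, the initial and the current one
included. -/
def Run.configs {n : ℕ} : Run n → List (Config n)
  | .start x => [x]
  | .round r _ y => y :: r.configs

/-- A strategy (FIFO, LIFO, random, ...) for choosing one ball from every non-empty bin. The choice
may be randomized and may depend on the whole history, but not on the future. -/
structure Strategy (n : ℕ) where
  select : Run n → PMF (Finset (Fin n))
  isSelection : ∀ r, ∀ s ∈ (select r).support, IsSelection r.current s

/-- Every ball of `s` is re-assigned to a bin, independently and uniformly at random; the other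
balls stay where they are. -/
noncomputable def rethrow {n : ℕ} (x : Config n) (s : Finset (Fin n)) : PMF (Config n) :=
  haveI : Nonempty (Config n) := ⟨x⟩
  (PMF.uniformOfFintype (Config n)).map fun u i => if i ∈ s then u i else x i

/-- The law of the history of the first `t` rounds of the repeated balls-into-bins process with
strategy `σ`, started from the configuration `x`. -/
noncomputable def runLaw {n : ℕ} (σ : Strategy n) (x : Config n) : ℕ → PMF (Run n)
  | 0 => PMF.pure (Run.start x)
  | t + 1 => (runLaw σ x t).bind fun r =>
      (σ.select r).bind fun s => (rethrow r.current s).map fun y => Run.round r s y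

/-- The probability of the event `S` for the process run for `t` rounds. -/
noncomputable def runProb {n : ℕ} (σ : Strategy n) (x : Config n) (t : ℕ) (S : Set (Run n)) : ℝ :=
  ((runLaw σ x t).toOuterMeasure S).toReal

/-! The proof follows the exponential potential `∑ b, 1.01 ^ load x b`. In one round a non-empty bin
loses one ball and receives Binomial(`s.card`, `1/n`) new ones, where `s.card` is the number of
non-empty bins. If a fraction `e` of the bins is empty, its term changes in mean by a factor of at
most `(1.0101 - 0.01 e) / 1.01`, which is below 1 once `e` exceeds a small constant.

A given configuration may have no empty bin, but after any round at least `n / 8` bins are empty on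
average (`le_rethrowMean_emptyBins`). Hence the potential contracts over two rounds, up to an error
`5 n` (`rethrowMean_nextPotential_le`). Only the number of extracted balls matters, so every
strategy obeys the same bounds.

The mean potential therefore stays polynomial in `n` if it starts so, and becomes `O(n)` after
`O(n)` rounds from any start. A maximum load above `K log n` forces a potential of at least `n ^ (K
* rate)`, so Markov's inequality gives both claims. -/

open scoped ENNReal

/-- The expectation of an extended nonnegative function under a probability mass function. -/
noncomputable def PMF.expect {α : Type*} (p : PMF α) (f : α → ℝ≥0∞) : ℝ≥0∞ :=
  ∑' a, p a * f a

/-! ### Expectation under a probability mass function. -/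

namespace PMF

variable {α β : Type*}

theorem expect_pure (a : α) (f : α → ℝ≥0∞) : (PMF.pure a).expect f = f a := by
  rw [expect, tsum_eq_single a]
  · simp
  · intro b hb
    simp [PMF.pure_apply, hb]

theorem expect_bind (p : PMF α) (g : α → PMF β) (f : β → ℝ≥0∞) :
    (p.bind g).expect f = p.expect fun a => (g a).expect f := by
  simp only [expect, PMF.bind_apply, ← ENNReal.tsum_mul_right, ← ENNReal.tsum_mul_left]
  rw [ENNReal.tsum_comm]
  simp only [mul_assoc]

theorem expect_map (p : PMF α) (g : α → β) (f : β → ℝ≥0∞) :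
    (p.map g).expect f = p.expect fun a => f (g a) := by
  rw [← PMF.bind_pure_comp, expect_bind]
  simp only [Function.comp_apply, expect_pure]

theorem expect_mono (p : PMF α) {f g : α → ℝ≥0∞} (h : ∀ a ∈ p.support, f a ≤ g a) :
    p.expect f ≤ p.expect g := by
  refine ENNReal.tsum_le_tsum fun a => ?_
  by_cases ha : a ∈ p.support
  · gcongr
    exact h a ha
  · rw [PMF.mem_support_iff, not_not] at ha
    simp [ha]

theorem expect_const (p : PMF α) (c : ℝ≥0∞) : (p.expect fun _ => c) = c := by
  simp [expect, ENNReal.tsum_mul_right, p.tsum_coe]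

theorem expect_le_const (p : PMF α) {f : α → ℝ≥0∞} {c : ℝ≥0∞} (h : ∀ a ∈ p.support, f a ≤ c) :
    p.expect f ≤ c :=
  (p.expect_mono h).trans_eq (p.expect_const c)

theorem expect_add (p : PMF α) (f g : α → ℝ≥0∞) :
    (p.expect fun a => f a + g a) = p.expect f + p.expect g := by
  simp only [expect, mul_add, ENNReal.tsum_add]

theorem expect_const_mul (p : PMF α) (c : ℝ≥0∞) (f : α → ℝ≥0∞) :
    (p.expect fun a => c * f a) = c * p.expect f := by
  simp only [expect, ← ENNReal.tsum_mul_left, mul_left_comm]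

/-- Markov's inequality. -/
theorem mul_toOuterMeasure_le_expect (p : PMF α) (f : α → ℝ≥0∞) (c : ℝ≥0∞) (S : Set α)
    (h : ∀ a ∈ S, c ≤ f a) : c * p.toOuterMeasure S ≤ p.expect f := by
  rw [PMF.toOuterMeasure_apply, ← ENNReal.tsum_mul_left]
  refine ENNReal.tsum_le_tsum fun a => ?_
  by_cases ha : a ∈ S
  · rw [Set.indicator_of_mem ha, mul_comm]
    gcongr
    exact h a ha
  · simp [ha]

theorem toOuterMeasure_add_compl (p : PMF α) (S : Set α) :
    p.toOuterMeasure S + p.toOuterMeasure Sᶜ = 1 := by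
  rw [PMF.toOuterMeasure_apply, PMF.toOuterMeasure_apply, ← ENNReal.tsum_add, ← p.tsum_coe]
  exact tsum_congr fun a => congrFun (Set.indicator_self_add_compl S p) a

end PMF

/-! ### Averages over one re-assignment of balls. -/

section Rethrow

variable {n : ℕ}

/-- The mean of `f` over the configurations that arise when the balls of `s` are re-assigned. -/
noncomputable def rethrowMean (x : Config n) (s : Finset (Fin n)) (f : Config n → ℝ) : ℝ :=
  (∑ u : Config n, f fun i => if i ∈ s then u i else x i) / (n : ℝ) ^ n

theorem expect_rethrow (x : Config n) (s : Finset (Fin n)) (f : Config n → ℝ) (hf : ∀ y, 0 ≤ f y) :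
    ((rethrow x s).expect fun y => ENNReal.ofReal (f y)) = ENNReal.ofReal (rethrowMean x s f) := by
  have : Nonempty (Config n) := ⟨x⟩
  have hn : (0 : ℝ) < (n : ℝ) ^ n := by
    rcases Nat.eq_zero_or_pos n with rfl | h
    · simp
    · positivity
  rw [rethrow, PMF.expect_map, PMF.expect, tsum_fintype, rethrowMean, div_eq_inv_mul,
    ENNReal.ofReal_mul (by positivity), ENNReal.ofReal_sum_of_nonneg fun u _ => hf _,
    Finset.mul_sum]
  refine Finset.sum_congr rfl fun u _ => ?_
  rw [PMF.uniformOfFintype_apply, ENNReal.ofReal_inv_of_pos hn]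
  congr 2
  rw [Fintype.card_fun, Fintype.card_fin, ← Nat.cast_pow, ENNReal.ofReal_natCast]

theorem rethrowMean_mono (x : Config n) (s : Finset (Fin n)) {f g : Config n → ℝ}
    (h : ∀ u : Config n, f (fun i => if i ∈ s then u i else x i) ≤
      g fun i => if i ∈ s then u i else x i) :
    rethrowMean x s f ≤ rethrowMean x s g := by
  unfold rethrowMean
  gcongr with u
  exact h u

theorem rethrowMean_sum {ι : Type*} (x : Config n) (s : Finset (Fin n)) (t : Finset ι)
    (f : ι → Config n → ℝ) :
    (rethrowMean x s fun y => ∑ b ∈ t, f b y) = ∑ b ∈ t, rethrowMean x s (f b) := by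
  simp only [rethrowMean]
  rw [Finset.sum_comm, Finset.sum_div]

theorem rethrowMean_sub (x : Config n) (s : Finset (Fin n)) (f g : Config n → ℝ) :
    (rethrowMean x s fun y => f y - g y) = rethrowMean x s f - rethrowMean x s g := by
  simp only [rethrowMean, Finset.sum_sub_distrib, sub_div]

theorem rethrowMean_const_mul (x : Config n) (s : Finset (Fin n)) (c : ℝ) (f : Config n → ℝ) :
    (rethrowMean x s fun y => c * f y) = c * rethrowMean x s f := by
  simp only [rethrowMean, ← Finset.mul_sum, mul_div_assoc]

theorem pow_load (z : ℝ) (x : Config n) (b : Fin n) :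
    z ^ load x b = ∏ i, if x i = b then z else 1 := by
  simp [load, Finset.prod_ite]

/-- The probability generating function of the load of a bin after the balls of `s` are
re-assigned. -/
theorem rethrowMean_pow_load (hn : n ≠ 0) (x : Config n) (s : Finset (Fin n)) (z : ℝ)
    (b : Fin n) :
    (rethrowMean x s fun y => z ^ load y b) =
      (1 + (z - 1) / n) ^ s.card * z ^ (Finset.univ.filter fun i => x i = b ∧ i ∉ s).card := by
  have hn' : (n : ℝ) ≠ 0 := by exact_mod_cast hn
  have h1 : ∀ u : Config n, z ^ load (fun i => if i ∈ s then u i else x i) b =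
      ∏ i, (fun i j => if (if i ∈ s then j else x i) = b then z else 1) i (u i) := fun u => by
    rw [pow_load]
  have h2 : ∀ i, (∑ j : Fin n, if (if i ∈ s then j else x i) = b then z else 1) / n =
      (if i ∈ s then 1 + (z - 1) / n else 1) * (if x i = b ∧ i ∉ s then z else 1) := by
    intro i
    by_cases hi : i ∈ s
    · have : ∀ j : Fin n, (if j = b then z else 1) = 1 + if j = b then z - 1 else 0 := by
        intro j; split_ifs <;> ring
      simp only [hi, if_true, not_true, and_false, if_false, mul_one, this,
        Finset.sum_add_distrib, Finset.sum_ite_eq', Finset.mem_univ, Finset.sum_const,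
        Finset.card_univ, Fintype.card_fin, nsmul_eq_mul]
      field_simp
    · simp only [hi, if_false, Finset.sum_const, Finset.card_univ, Fintype.card_fin,
        nsmul_eq_mul, not_false_eq_true, and_true, one_mul]
      field_simp
  -- Independence: the sum over all `u` of a product over balls is the product of the sums.
  have h3 := Finset.prod_univ_sum (fun _ : Fin n => (Finset.univ : Finset (Fin n)))
    (fun i j => if (if i ∈ s then j else x i) = b then z else 1)
  rw [Fintype.piFinset_univ] at h3
  rw [rethrowMean, Finset.sum_congr rfl fun u _ => h1 u, ← h3]
  have h4 : (n : ℝ) ^ n = ∏ _i : Fin n, (n : ℝ) := by simp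
  rw [h4, ← Finset.prod_div_distrib, Finset.prod_congr rfl fun i _ => h2 i,
    Finset.prod_mul_distrib]
  simp [Finset.prod_ite]

end Rethrow

/-! ### Loads, selections and empty bins. -/

section Loads

variable {n : ℕ}

/-- The number of empty bins. -/
def emptyBins (x : Config n) : ℕ :=
  (Finset.univ.filter fun b => load x b = 0).card

theorem sum_load (x : Config n) : ∑ b, load x b = n := by
  have := Finset.card_eq_sum_card_fiberwise (f := x) (s := Finset.univ) (t := Finset.univ)
    (by simp)
  simpa [load] using this.symm

theorem IsSelection.card_filter {x : Config n} {s : Finset (Fin n)} (h : IsSelection x s)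
    (b : Fin n) : (s.filter fun i => x i = b).card = if load x b = 0 then 0 else 1 := by
  split_ifs with hb
  · rw [load, Finset.card_eq_zero, Finset.filter_eq_empty_iff] at hb
    rw [Finset.card_eq_zero, Finset.filter_eq_empty_iff]
    exact fun i _ => hb (Finset.mem_univ i)
  · obtain ⟨i, hi⟩ := Finset.card_pos.1 (Nat.pos_of_ne_zero hb)
    obtain ⟨j, hj, hu⟩ := h b ⟨i, (Finset.mem_filter.1 hi).2⟩
    rw [Finset.card_eq_one]
    refine ⟨j, Finset.ext fun k => ?_⟩
    rw [Finset.mem_filter, Finset.mem_singleton]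
    exact ⟨hu k, fun hk => hk ▸ hj⟩

theorem IsSelection.card_add_emptyBins {x : Config n} {s : Finset (Fin n)}
    (h : IsSelection x s) : s.card + emptyBins x = n := by
  have h1 := Finset.card_eq_sum_card_fiberwise (f := x) (s := s) (t := Finset.univ) (by simp)
  have h2 : emptyBins x = ∑ b, if load x b = 0 then 1 else 0 := by
    rw [emptyBins, Finset.card_filter]
  rw [h1, h2, ← Finset.sum_add_distrib, Finset.sum_congr rfl fun b _ => ?_]
  · rw [Finset.sum_const, Finset.card_univ, Fintype.card_fin, smul_eq_mul, mul_one]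
  · rw [h.card_filter b]
    split_ifs <;> rfl

/-- Truncated subtraction covers the empty bin, which loses no ball. -/
theorem IsSelection.card_stay {x : Config n} {s : Finset (Fin n)} (h : IsSelection x s)
    (b : Fin n) : (Finset.univ.filter fun i => x i = b ∧ i ∉ s).card = load x b - 1 := by
  have h1 := Finset.card_filter_add_card_filter_not (s := Finset.univ.filter fun i => x i = b)
    (fun i => i ∈ s)
  rw [Finset.filter_filter, Finset.filter_filter] at h1
  have h2 : (Finset.univ.filter fun i => x i = b ∧ i ∈ s) = s.filter fun i => x i = b := by
    ext i; simp [and_comm]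
  rw [h2, h.card_filter b] at h1
  change _ = load x b at h1
  split_ifs at h1 <;> omega

theorem rethrowMean_pow_load_of_isSelection (hn : n ≠ 0) {x : Config n} {s : Finset (Fin n)}
    (h : IsSelection x s) (z : ℝ) (b : Fin n) :
    (rethrowMean x s fun y => z ^ load y b) =
      (1 + (z - 1) / n) ^ s.card * z ^ (load x b - 1) := by
  rw [rethrowMean_pow_load hn, h.card_stay]

/-- The average load is 1, so at most half of the bins can hold two or more balls. -/
theorem le_two_mul_card_load_le_one (x : Config n) :
    n ≤ 2 * (Finset.univ.filter fun b => load x b ≤ 1).card := by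
  have h1 := sum_load x
  have h2 : ∑ b, 2 * (if load x b ≤ 1 then 0 else 1) ≤ ∑ b, load x b :=
    Finset.sum_le_sum fun b _ => by split_ifs <;> omega
  have h3 : ∑ b, ((if load x b ≤ 1 then 1 else 0) + if load x b ≤ 1 then 0 else 1) = n := by
    rw [Finset.sum_congr rfl fun b _ => (by split_ifs <;> rfl : _ = 1)]
    simp
  rw [Finset.sum_add_distrib] at h3
  rw [← Finset.mul_sum] at h2
  rw [Finset.card_filter]
  omega

theorem load_le_rethrow {x : Config n} {s : Finset (Fin n)} (h : IsSelection x s) (u : Config n)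
    (b : Fin n) : load x b - 1 ≤ load (fun i => if i ∈ s then u i else x i) b := by
  rw [← h.card_stay b, load]
  refine Finset.card_le_card fun i hi => ?_
  simp only [Finset.mem_filter, Finset.mem_univ, true_and] at hi ⊢
  rw [if_neg hi.2, hi.1]

theorem load_le (x : Config n) (b : Fin n) : load x b ≤ n :=
  (Finset.card_le_univ _).trans_eq (Fintype.card_fin n)

theorem one_fourth_le_pow (hn : 2 ≤ n) : (1 / 4 : ℝ) ≤ (1 - 1 / n) ^ n := by
  have hn' : (2 : ℝ) ≤ n := by exact_mod_cast hn
  have h0 : (0 : ℝ) ≤ 1 - 1 / n := by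
    rw [sub_nonneg, div_le_one (by linarith)]; linarith
  -- Bernoulli with exponent `n / 2`, which is at least 1 because `n ≥ 2`, gives `1 / 2`; squaring
  -- then gives `1 / 4`.
  have h1 := one_add_mul_self_le_rpow_one_add (s := -1 / n) (p := n / 2)
    (by rw [le_div_iff₀ (by linarith)]; linarith) (by linarith)
  have h2 : 1 + (n / 2 : ℝ) * (-1 / n) = 1 / 2 := by field_simp; norm_num
  rw [h2, show (1 : ℝ) + -1 / n = 1 - 1 / n by ring] at h1
  have h3 : (1 - 1 / n : ℝ) ^ n = ((1 - 1 / n : ℝ) ^ (n / 2 : ℝ)) ^ 2 := by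
    rw [← Real.rpow_natCast, ← Real.rpow_natCast, ← Real.rpow_mul h0]
    congr 1
    push_cast
    ring
  rw [h3]
  nlinarith

/-- After one round, a constant fraction of the bins is empty on average. -/
theorem le_rethrowMean_emptyBins (hn : 2 ≤ n) {x : Config n} {s : Finset (Fin n)}
    (h : IsSelection x s) : (n : ℝ) / 8 ≤ rethrowMean x s fun y => (emptyBins y : ℝ) := by
  have hn' : (2 : ℝ) ≤ n := by exact_mod_cast hn
  have h0 : (0 : ℝ) ≤ 1 - 1 / n := by
    rw [sub_nonneg, div_le_one (by linarith)]; linarith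
  -- Since `0 ^ 0 = 1`, the generating function at `z = 0` is the probability that the bin is empty.
  -- Bins of load at most 1 keep no ball, so each of them is empty with probability at least `1 /
  -- 4`.
  have h1 : ∀ y : Config n, (emptyBins y : ℝ) = ∑ b, (0 : ℝ) ^ load y b := by
    intro y
    rw [emptyBins, Finset.card_filter]
    push_cast
    exact Finset.sum_congr rfl fun b _ => by rw [zero_pow_eq]
  simp only [h1]
  rw [rethrowMean_sum]
  have h2 : ∀ b ∈ Finset.univ.filter (fun b => load x b ≤ 1),
      (1 / 4 : ℝ) ≤ rethrowMean x s fun y => (0 : ℝ) ^ load y b := by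
    intro b hb
    rw [rethrowMean_pow_load_of_isSelection (by omega) h,
      Nat.sub_eq_zero_of_le (Finset.mem_filter.1 hb).2, pow_zero, mul_one,
      show (1 : ℝ) + (0 - 1) / n = 1 - 1 / n by ring]
    refine (one_fourth_le_pow hn).trans (pow_le_pow_of_le_one h0 ?_ ?_)
    · have : (0 : ℝ) ≤ 1 / n := by positivity
      linarith
    · have := h.card_add_emptyBins
      omega
  have h3 := Finset.card_nsmul_le_sum _ _ _ h2
  have h4 : ∑ b ∈ Finset.univ.filter (fun b => load x b ≤ 1),
      (rethrowMean x s fun y => (0 : ℝ) ^ load y b) ≤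
      ∑ b, rethrowMean x s fun y => (0 : ℝ) ^ load y b := by
    refine Finset.sum_le_sum_of_subset_of_nonneg (Finset.filter_subset _ _) fun b _ _ => ?_
    unfold rethrowMean
    positivity
  have h5 : (n : ℝ) ≤ 2 * (Finset.univ.filter fun b => load x b ≤ 1).card := by
    exact_mod_cast le_two_mul_card_load_le_one x
  rw [nsmul_eq_mul] at h3
  linarith

end Loads

/-! ### Drift of the exponential potential. -/

section Drift

variable {n : ℕ}

/-- The exponential potential of a configuration. -/
noncomputable def potential (x : Config n) : ℝ :=
  ∑ b, (101 / 100 : ℝ) ^ load x b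

theorem potential_nonneg (x : Config n) : 0 ≤ potential x := by
  unfold potential
  positivity

theorem pow_maxLoad_le_potential (hn : n ≠ 0) (x : Config n) :
    (101 / 100 : ℝ) ^ maxLoad x ≤ potential x := by
  have : Nonempty (Fin n) := ⟨⟨0, Nat.pos_of_ne_zero hn⟩⟩
  obtain ⟨b, -, hb⟩ := Finset.exists_mem_eq_sup Finset.univ Finset.univ_nonempty (load x)
  rw [maxLoad, hb]
  exact Finset.single_le_sum (f := fun b => (101 / 100 : ℝ) ^ load x b)
    (fun b _ => by positivity) (Finset.mem_univ b)

theorem potential_le (x : Config n) : potential x ≤ n * (101 / 100 : ℝ) ^ maxLoad x := by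
  have := Finset.sum_le_card_nsmul Finset.univ (fun b => (101 / 100 : ℝ) ^ load x b)
    ((101 / 100 : ℝ) ^ maxLoad x) fun b hb =>
      pow_le_pow_right₀ (by norm_num) (Finset.le_sup (f := load x) hb)
  simpa [potential] using this

theorem maxLoad_le (x : Config n) : maxLoad x ≤ n :=
  Finset.sup_le fun b _ => load_le x b

theorem emptyBins_le (x : Config n) : emptyBins x ≤ n :=
  (Finset.card_le_univ _).trans_eq (Fintype.card_fin n)

theorem one_add_pow_card_le (hn : n ≠ 0) {x : Config n} {s : Finset (Fin n)}
    (h : IsSelection x s) :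
    (1 + (101 / 100 - 1 : ℝ) / n) ^ s.card ≤
      10101 / 10000 - 1 / 100 * ((emptyBins x : ℝ) / n) := by
  have hn' : (0 : ℝ) < n := by exact_mod_cast Nat.pos_of_ne_zero hn
  have hc : (s.card : ℝ) + emptyBins x = n := by exact_mod_cast h.card_add_emptyBins
  have he : (emptyBins x : ℝ) / n = 1 - s.card / n := by field_simp; linarith
  have hw : (s.card : ℝ) / n ≤ 1 := by
    rw [div_le_one hn']
    have : (0 : ℝ) ≤ emptyBins x := by positivity
    linarith
  have hw0 : 0 ≤ (s.card : ℝ) / n := by positivity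
  set w := (s.card : ℝ) / n with hwdef
  have h1 : (1 + (101 / 100 - 1 : ℝ) / n) ^ s.card ≤ Real.exp (w / 100) := by
    have h2 : w / 100 = s.card * ((101 / 100 - 1 : ℝ) / n) := by
      rw [hwdef]; ring
    rw [h2, Real.exp_nat_mul]
    refine pow_le_pow_left₀ (by norm_num; positivity) ?_ _
    rw [add_comm]
    exact Real.add_one_le_exp _
  -- `exp (w / 100) ≤ 1 + w / 100 + (w / 100) ^ 2`, and `w ≤ 1` bounds the square by `1 / 10000`.
  have h3 := Real.abs_exp_sub_one_sub_id_le (x := w / 100) (by rw [abs_le]; constructor <;> linarith)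
  have h4 := (abs_le.1 h3).2
  rw [he]
  nlinarith

theorem rethrowMean_pow_load_le (hn : n ≠ 0) {x : Config n} {s : Finset (Fin n)}
    (h : IsSelection x s) (b : Fin n) :
    (rethrowMean x s fun y => (101 / 100 : ℝ) ^ load y b) ≤
      (10101 / 10000 - 1 / 100 * ((emptyBins x : ℝ) / n)) * (101 / 100) ^ (load x b - 1) := by
  rw [rethrowMean_pow_load_of_isSelection hn h]
  gcongr
  exact one_add_pow_card_le hn h

/-- A bound on the mean potential after the next round. -/
noncomputable def nextPotential (x : Config n) : ℝ :=
  ∑ b, (10101 / 10000 - 1 / 100 * ((emptyBins x : ℝ) / n)) * (101 / 100) ^ (load x b - 1)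

theorem emptyBins_div_le_one (x : Config n) : (emptyBins x : ℝ) / n ≤ 1 :=
  div_le_one_of_le₀ (by exact_mod_cast emptyBins_le x) (by positivity)

theorem nextPotential_nonneg (x : Config n) : 0 ≤ nextPotential x := by
  refine Finset.sum_nonneg fun b _ => mul_nonneg ?_ (by positivity)
  have := emptyBins_div_le_one x
  linarith

theorem nextPotential_le (x : Config n) : nextPotential x ≤ 2 * potential x := by
  rw [potential, Finset.mul_sum]
  refine Finset.sum_le_sum fun b _ => ?_
  have : (0 : ℝ) ≤ (emptyBins x : ℝ) / n := by positivity
  gcongr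
  · linarith
  · norm_num
  · omega

theorem rethrowMean_potential_le (hn : n ≠ 0) {x : Config n} {s : Finset (Fin n)}
    (h : IsSelection x s) : rethrowMean x s potential ≤ nextPotential x := by
  change (rethrowMean x s fun y => ∑ b, (101 / 100 : ℝ) ^ load y b) ≤ _
  rw [rethrowMean_sum]
  exact Finset.sum_le_sum fun b _ => rethrowMean_pow_load_le hn h b

/-- The number of empty bins and the load of `b` after the round are dependent. In the negative term
the load is replaced by its deterministic lower bound `load x b - 1`, so that only the mean number
of empty bins is needed. The resulting factor is at most `(1.0101 ^ 2 - 1 / 800) / 1.01 ^ 2 <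
0.999`. -/
theorem rethrowMean_next_le_of_two_le (hn : 2 ≤ n) {x : Config n} {s : Finset (Fin n)}
    (h : IsSelection x s) {b : Fin n} (hb : 2 ≤ load x b) :
    (rethrowMean x s fun y =>
      (10101 / 10000 - 1 / 100 * ((emptyBins y : ℝ) / n)) * (101 / 100) ^ (load y b - 1)) ≤
      999 / 1000 * (101 / 100) ^ load x b := by
  have hn' : (0 : ℝ) < n := by exact_mod_cast (by omega : 0 < n)
  obtain ⟨l, hl⟩ : ∃ l, load x b = l + 2 := ⟨load x b - 2, by omega⟩
  have h1 : (rethrowMean x s fun y =>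
      (10101 / 10000 - 1 / 100 * ((emptyBins y : ℝ) / n)) * (101 / 100) ^ (load y b - 1)) ≤
      rethrowMean x s fun y => 10101 / 10000 * (100 / 101) * (101 / 100 : ℝ) ^ load y b -
        1 / 100 * (101 / 100) ^ l / n * emptyBins y := by
    refine rethrowMean_mono x s fun u => ?_
    have hle := load_le_rethrow h u b
    set y : Config n := fun i => if i ∈ s then u i else x i
    obtain ⟨m, hm⟩ : ∃ m, load y b = m + 1 := ⟨load y b - 1, by omega⟩
    have hlm : (101 / 100 : ℝ) ^ l ≤ (101 / 100) ^ m :=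
      pow_le_pow_right₀ (by norm_num) (by omega)
    have he : (0 : ℝ) ≤ (emptyBins y : ℝ) / n := by positivity
    rw [hm, Nat.add_sub_cancel, pow_succ]
    have : 1 / 100 * (101 / 100 : ℝ) ^ l / n * emptyBins y =
      1 / 100 * ((emptyBins y : ℝ) / n * (101 / 100) ^ l) := by ring
    rw [this]
    nlinarith [mul_le_mul_of_nonneg_left hlm he]
  refine h1.trans ?_
  rw [rethrowMean_sub, rethrowMean_const_mul, rethrowMean_const_mul]
  have h2 := rethrowMean_pow_load_le (by omega) h b
  have h3 := le_rethrowMean_emptyBins hn h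
  have he : (0 : ℝ) ≤ (emptyBins x : ℝ) / n := by positivity
  rw [hl, show l + 2 - 1 = l + 1 by omega, pow_succ] at h2
  rw [hl, pow_add]
  have hp : (0 : ℝ) < (101 / 100) ^ l := by positivity
  have h4 : 1 / 100 * (101 / 100 : ℝ) ^ l / n * (n / 8) ≤
      1 / 100 * (101 / 100 : ℝ) ^ l / n * rethrowMean x s fun y => (emptyBins y : ℝ) := by
    gcongr
  have h5 : 1 / 100 * (101 / 100 : ℝ) ^ l / n * (n / 8) = (101 / 100 : ℝ) ^ l / 800 := by
    field_simp; norm_num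
  nlinarith [mul_nonneg he hp.le]

/-- Light bins need no contraction: a crude constant goes into the additive error. -/
theorem rethrowMean_next_le_of_le_one (hn : n ≠ 0) {x : Config n} {s : Finset (Fin n)}
    (h : IsSelection x s) {b : Fin n} (hb : load x b ≤ 1) :
    (rethrowMean x s fun y =>
      (10101 / 10000 - 1 / 100 * ((emptyBins y : ℝ) / n)) * (101 / 100) ^ (load y b - 1)) ≤
      5 := by
  have h1 : (rethrowMean x s fun y =>
      (10101 / 10000 - 1 / 100 * ((emptyBins y : ℝ) / n)) * (101 / 100) ^ (load y b - 1)) ≤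
      rethrowMean x s fun y => 2 * (101 / 100 : ℝ) ^ load y b := by
    refine rethrowMean_mono x s fun u => ?_
    set y : Config n := fun i => if i ∈ s then u i else x i
    have : (0 : ℝ) ≤ (emptyBins y : ℝ) / n := by positivity
    gcongr
    · linarith
    · norm_num
    · omega
  refine h1.trans ?_
  rw [rethrowMean_const_mul]
  have h2 := rethrowMean_pow_load_le hn h b
  have he : (0 : ℝ) ≤ (emptyBins x : ℝ) / n := by positivity
  rw [Nat.sub_eq_zero_of_le hb, pow_zero] at h2
  linarith

/-- Over two rounds the potential contracts, up to an additive error linear in `n`. -/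
theorem rethrowMean_nextPotential_le (hn : 2 ≤ n) {x : Config n} {s : Finset (Fin n)}
    (h : IsSelection x s) :
    rethrowMean x s nextPotential ≤ 999 / 1000 * potential x + 5 * n := by
  unfold nextPotential
  rw [rethrowMean_sum]
  have : (999 / 1000 * potential x + 5 * n : ℝ) =
      ∑ b, (999 / 1000 * (101 / 100 : ℝ) ^ load x b + 5) := by
    rw [Finset.sum_add_distrib, potential, Finset.mul_sum]
    simp [mul_comm]
  rw [this]
  refine Finset.sum_le_sum fun b _ => ?_
  have hp : (0 : ℝ) < (101 / 100) ^ load x b := by positivity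
  rcases Nat.lt_or_ge (load x b) 2 with hb | hb
  · have := rethrowMean_next_le_of_le_one (by omega) h (b := b) (by omega)
    linarith
  · have := rethrowMean_next_le_of_two_le hn h hb
    linarith

end Drift

/-! ### Mean potential along the process. -/

section Dynamics

variable {n : ℕ}

theorem expect_runLaw_succ (σ : Strategy n) (x : Config n) (t : ℕ) (f : Run n → ℝ≥0∞) :
    (runLaw σ x (t + 1)).expect f = (runLaw σ x t).expect fun r => (σ.select r).expect fun s =>
      (rethrow r.current s).expect fun y => f (Run.round r s y) := by
  simp only [runLaw, PMF.expect_bind, PMF.expect_map]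

/-- The mean potential after `t` rounds. -/
noncomputable def meanPotential (σ : Strategy n) (x : Config n) (t : ℕ) : ℝ≥0∞ :=
  (runLaw σ x t).expect fun r => ENNReal.ofReal (potential r.current)

theorem expect_potential_round_le (hn : n ≠ 0) (σ : Strategy n) (r : Run n) :
    ((σ.select r).expect fun s => (rethrow r.current s).expect fun y =>
      ENNReal.ofReal (potential y)) ≤ ENNReal.ofReal (nextPotential r.current) := by
  refine PMF.expect_le_const _ fun s hs => ?_
  rw [expect_rethrow _ _ _ potential_nonneg]
  exact ENNReal.ofReal_le_ofReal (rethrowMean_potential_le hn (σ.isSelection r s hs))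

theorem meanPotential_zero (σ : Strategy n) (x : Config n) :
    meanPotential σ x 0 = ENNReal.ofReal (potential x) := by
  simp [meanPotential, runLaw, PMF.expect_pure, Run.current]

/-- Crude growth bound, used to pass from even to odd rounds. -/
theorem meanPotential_succ_le (hn : n ≠ 0) (σ : Strategy n) (x : Config n) (t : ℕ) :
    meanPotential σ x (t + 1) ≤ 2 * meanPotential σ x t := by
  rw [meanPotential, expect_runLaw_succ, meanPotential, ← PMF.expect_const_mul]
  refine PMF.expect_mono _ fun r _ => (expect_potential_round_le hn σ r).trans ?_
  rw [← ENNReal.ofReal_ofNat 2, ← ENNReal.ofReal_mul (by norm_num)]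
  exact ENNReal.ofReal_le_ofReal (nextPotential_le _)

theorem meanPotential_add_two_le (hn : 2 ≤ n) (σ : Strategy n) (x : Config n) (t : ℕ) :
    meanPotential σ x (t + 2) ≤
      ENNReal.ofReal (999 / 1000) * meanPotential σ x t + ENNReal.ofReal (5 * n) := by
  rw [meanPotential, expect_runLaw_succ, expect_runLaw_succ, meanPotential,
    ← PMF.expect_const_mul, ← PMF.expect_const (runLaw σ x t) (ENNReal.ofReal (5 * n)),
    ← PMF.expect_add]
  refine PMF.expect_mono _ fun r _ => PMF.expect_le_const _ fun s hs => ?_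
  refine (PMF.expect_mono _ fun y _ =>
    expect_potential_round_le (by omega) σ (Run.round r s y)).trans ?_
  change (rethrow r.current s).expect (fun y => ENNReal.ofReal (nextPotential y)) ≤ _
  rw [expect_rethrow _ _ _ nextPotential_nonneg, ← ENNReal.ofReal_mul (by norm_num),
    ← ENNReal.ofReal_add (mul_nonneg (by norm_num) (potential_nonneg _)) (by positivity)]
  exact ENNReal.ofReal_le_ofReal (rethrowMean_nextPotential_le hn (σ.isSelection r s hs))

/-- `5000 n` is the fixed point of `a ↦ 0.999 a + 5 n`. -/
theorem meanPotential_two_mul_le (hn : 2 ≤ n) (σ : Strategy n) (x : Config n) (k : ℕ) :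
    meanPotential σ x (2 * k) ≤
      ENNReal.ofReal ((999 / 1000) ^ k * potential x + 5000 * n) := by
  have hp := potential_nonneg x
  induction k with
  | zero =>
    rw [mul_zero, meanPotential_zero]
    refine ENNReal.ofReal_le_ofReal ?_
    have : (0 : ℝ) ≤ 5000 * n := by positivity
    linarith
  | succ k ih =>
    refine (meanPotential_add_two_le hn σ x (2 * k)).trans ?_
    refine (add_le_add_left (mul_le_mul_right ih _) _).trans ?_
    rw [← ENNReal.ofReal_mul (by norm_num), ← ENNReal.ofReal_add (by positivity) (by positivity)]
    refine ENNReal.ofReal_le_ofReal (le_of_eq ?_)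
    ring

theorem meanPotential_le (hn : 2 ≤ n) (σ : Strategy n) (x : Config n) (t : ℕ) :
    meanPotential σ x t ≤ ENNReal.ofReal (2 * (potential x + 5000 * n)) := by
  have hp := potential_nonneg x
  have h1 : ∀ k : ℕ, meanPotential σ x (2 * k) ≤ ENNReal.ofReal (potential x + 5000 * n) :=
    fun k => (meanPotential_two_mul_le hn σ x k).trans <| ENNReal.ofReal_le_ofReal <| by
      gcongr
      exact mul_le_of_le_one_left hp (pow_le_one₀ (by norm_num) (by norm_num))
  rw [ENNReal.ofReal_mul (by norm_num), ENNReal.ofReal_ofNat]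
  obtain ⟨k, rfl | rfl⟩ := Nat.even_or_odd' t
  · exact (h1 k).trans (le_mul_of_one_le_left' (by norm_num))
  · exact (meanPotential_succ_le (by omega) σ x _).trans (by gcongr; exact h1 k)

theorem expect_sum_configs (σ : Strategy n) (x : Config n) (f : Config n → ℝ≥0∞) (T : ℕ) :
    ((runLaw σ x T).expect fun r => (r.configs.map f).sum) =
      ∑ t ∈ Finset.range (T + 1), (runLaw σ x t).expect fun r => f r.current := by
  induction T with
  | zero => simp [runLaw, PMF.expect_pure, Run.current, Run.configs]
  | succ T ih =>
    rw [Finset.sum_range_succ, ← ih, expect_runLaw_succ, expect_runLaw_succ, ← PMF.expect_add]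
    simp only [Run.configs, Run.current, List.map_cons, List.sum_cons, PMF.expect_add,
      PMF.expect_const, add_comm]

theorem current_mem_configs (r : Run n) : r.current ∈ r.configs := by
  cases r <;> simp [Run.current, Run.configs]

/-! ### From mean potential to probabilities. -/

theorem runProb_ge (σ : Strategy n) (x : Config n) (t : ℕ) (S : Set (Run n)) {ε : ℝ}
    (hε : 0 ≤ ε) (h : (runLaw σ x t).toOuterMeasure Sᶜ ≤ ENNReal.ofReal ε) :
    1 - ε ≤ runProb σ x t S := by
  have h1 := (runLaw σ x t).toOuterMeasure_add_compl S
  have hS : (runLaw σ x t).toOuterMeasure S ≠ ∞ :=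
    ne_top_of_le_ne_top ENNReal.one_ne_top (h1 ▸ le_self_add)
  unfold runProb
  have h2 : ENNReal.ofReal 1 ≤
      ENNReal.ofReal (((runLaw σ x t).toOuterMeasure S).toReal + ε) := by
    rw [ENNReal.ofReal_one, ← h1, ENNReal.ofReal_add ENNReal.toReal_nonneg hε,
      ENNReal.ofReal_toReal hS]
    gcongr
  have h3 := (ENNReal.ofReal_le_ofReal_iff (add_nonneg ENNReal.toReal_nonneg hε)).1 h2
  linarith

/-- The exponent for which `(101 / 100) ^ log n = n ^ rate`. -/
noncomputable abbrev rate : ℝ := Real.log (101 / 100)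

theorem rate_pos : 0 < rate := Real.log_pos (by norm_num)

theorem rpow_mul_log (hn : 2 ≤ n) (K : ℝ) :
    (101 / 100 : ℝ) ^ (K * Real.log n) = (n : ℝ) ^ (K * rate) := by
  have hn' : (0 : ℝ) < n := by exact_mod_cast (by omega : 0 < n)
  rw [Real.rpow_def_of_pos (by norm_num), Real.rpow_def_of_pos hn', rate]
  congr 1
  ring

theorem rpow_le_potential_of_not_isLegitimate (hn : 2 ≤ n) {K : ℝ} {x : Config n}
    (h : ¬ IsLegitimate K x) : (n : ℝ) ^ (K * rate) ≤ potential x := by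
  rw [IsLegitimate, not_le] at h
  refine le_trans ?_ (pow_maxLoad_le_potential (by omega) x)
  rw [← rpow_mul_log hn, ← Real.rpow_natCast]
  exact Real.rpow_le_rpow_of_exponent_le (by norm_num) h.le

/-- A positive constant is at most a constant power of `n ≥ 2`. -/
theorem le_rpow_log_div_log_two (hn : 2 ≤ n) {B : ℝ} (hB : 1 ≤ B) :
    B ≤ (n : ℝ) ^ (Real.log B / Real.log 2) := by
  have hn' : (2 : ℝ) ≤ n := by exact_mod_cast hn
  have h2 := Real.log_pos (by norm_num : (1 : ℝ) < 2)
  have h0 := Real.log_nonneg hB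
  calc B = (2 : ℝ) ^ (Real.log B / Real.log 2) := by
        rw [Real.rpow_def_of_pos (by norm_num), mul_div_cancel₀ _ h2.ne',
          Real.exp_log (by linarith)]
    _ ≤ _ := Real.rpow_le_rpow (by norm_num) hn' (by positivity)

/-- Markov's inequality in the form in which it is used for both parts of the theorem. -/
theorem runProb_ge_of_expect_le (hn : 2 ≤ n) (σ : Strategy n) (x : Config n) (t : ℕ)
    (S : Set (Run n)) (f : Run n → ℝ≥0∞) {B p γ K : ℝ} (hB : 1 ≤ B)
    (hK : K * rate = γ + p + Real.log B / Real.log 2)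
    (hS : ∀ r ∉ S, ENNReal.ofReal ((n : ℝ) ^ (K * rate)) ≤ f r)
    (hf : (runLaw σ x t).expect f ≤ ENNReal.ofReal (B * (n : ℝ) ^ p)) :
    1 - (n : ℝ) ^ (-γ) ≤ runProb σ x t S := by
  have hn' : (0 : ℝ) < n := by exact_mod_cast (by omega : 0 < n)
  refine runProb_ge σ x t S (by positivity) ?_
  have h1 := ((runLaw σ x t).mul_toOuterMeasure_le_expect f _ Sᶜ hS).trans hf
  have h2 : B * (n : ℝ) ^ p ≤ (n : ℝ) ^ (K * rate) * (n : ℝ) ^ (-γ) := by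
    rw [← Real.rpow_add hn', hK,
      show γ + p + Real.log B / Real.log 2 + -γ = Real.log B / Real.log 2 + p by ring,
      Real.rpow_add hn']
    gcongr
    exact le_rpow_log_div_log_two hn hB
  have h3 := h1.trans (ENNReal.ofReal_le_ofReal h2)
  rw [ENNReal.ofReal_mul (by positivity)] at h3
  refine (ENNReal.mul_le_mul_iff_right ?_ ENNReal.ofReal_ne_top).1 h3
  rw [Ne, ENNReal.ofReal_eq_zero, not_le]
  positivity

/-- Markov is applied to the sum of the potentials over the whole history, which acts as a union
bound over the `T + 1` configurations. -/
theorem stability (c A L γ : ℝ) : ∃ K : ℝ, ∀ n : ℕ, 2 ≤ n → ∀ (σ : Strategy n) (x : Config n),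
    IsLegitimate L x → ∀ T : ℕ, (T : ℝ) ≤ A * (n : ℝ) ^ c →
      1 - (n : ℝ) ^ (-γ) ≤ runProb σ x T {r | ∀ y ∈ r.configs, IsLegitimate K y} := by
  have hr := rate_pos
  set p : ℝ := |c| + (1 + |L| * rate) with hp
  -- `|A| + 1` comes from the number of configurations, and `10002 = 2 * (1 + 5000)` from
  -- `meanPotential_le`.
  set B : ℝ := (|A| + 1) * 10002 with hB
  refine ⟨(γ + p + Real.log B / Real.log 2) / rate, fun n hn σ x hx T hT => ?_⟩
  have hn' : (2 : ℝ) ≤ n := by exact_mod_cast hn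
  have hn1 : (1 : ℝ) ≤ n := by linarith
  have hx' : potential x ≤ (n : ℝ) ^ (1 + |L| * rate) := by
    refine (potential_le x).trans ?_
    rw [Real.rpow_add (by linarith), Real.rpow_one, ← rpow_mul_log hn, ← Real.rpow_natCast]
    gcongr
    · norm_num
    · exact hx.trans (mul_le_mul_of_nonneg_right (le_abs_self L) (Real.log_nonneg hn1))
  have hnp : (n : ℝ) ≤ (n : ℝ) ^ (1 + |L| * rate) :=
    Real.self_le_rpow_of_one_le hn1 (le_add_of_nonneg_right (by positivity))
  have hT' : (T + 1 : ℝ) ≤ (|A| + 1) * (n : ℝ) ^ |c| := by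
    have h1 : A * (n : ℝ) ^ c ≤ |A| * (n : ℝ) ^ |c| := by
      gcongr
      · exact le_abs_self A
      · exact le_abs_self c
    have h2 : 1 ≤ (n : ℝ) ^ |c| := Real.one_le_rpow hn1 (abs_nonneg c)
    linarith
  refine runProb_ge_of_expect_le hn σ x T _
    (fun r => (r.configs.map fun y => ENNReal.ofReal (potential y)).sum) (B := B) (p := p)
    ?_ (div_mul_cancel₀ _ hr.ne') ?_ ?_
  · have := abs_nonneg A
    linarith
  · intro r hS
    simp only [Set.mem_ofPred_eq, not_forall] at hS
    obtain ⟨y, hy, hy'⟩ := hS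
    exact (ENNReal.ofReal_le_ofReal (rpow_le_potential_of_not_isLegitimate hn hy')).trans
      (List.le_sum_of_mem (List.mem_map_of_mem hy))
  · rw [expect_sum_configs]
    refine (Finset.sum_le_card_nsmul _ _ _ fun t _ => meanPotential_le hn σ x t).trans ?_
    rw [Finset.card_range, nsmul_eq_mul, ← ENNReal.ofReal_natCast,
      ← ENNReal.ofReal_mul (by positivity)]
    refine ENNReal.ofReal_le_ofReal ?_
    have h0 := potential_nonneg x
    calc ((T + 1 : ℕ) : ℝ) * (2 * (potential x + 5000 * n))
        ≤ ((|A| + 1) * (n : ℝ) ^ |c|) * (10002 * (n : ℝ) ^ (1 + |L| * rate)) := by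
          refine mul_le_mul ?_ (by linarith) (by positivity) (by positivity)
          push_cast
          exact hT'
      _ = B * (n : ℝ) ^ p := by
          rw [hp, Real.rpow_add (by linarith) |c|, hB]
          ring

theorem convergence (γ : ℝ) : ∃ (K : ℝ) (C : ℕ), ∀ n : ℕ, 2 ≤ n →
    ∀ (σ : Strategy n) (x : Config n),
      1 - (n : ℝ) ^ (-γ) ≤ runProb σ x (C * n) {r | ∃ y ∈ r.configs, IsLegitimate K y} := by
  have hr := rate_pos
  -- The last configuration alone suffices. `40 n` rounds are `20 n` contractions, enough to cancel
  -- an initial potential of up to `n * 1.01 ^ n`, because `0.999 ^ 20 * 1.01 ≤ 1`.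
  refine ⟨(γ + 1 + Real.log 5001 / Real.log 2) / rate, 40, fun n hn σ x => ?_⟩
  refine runProb_ge_of_expect_le hn σ x _ _ (fun r => ENNReal.ofReal (potential r.current))
    (B := 5001) (p := 1) (by norm_num) (div_mul_cancel₀ _ hr.ne') ?_ ?_
  · intro r hS
    simp only [Set.mem_ofPred_eq, not_exists, not_and] at hS
    exact ENNReal.ofReal_le_ofReal
      (rpow_le_potential_of_not_isLegitimate hn (hS _ (current_mem_configs r)))
  · rw [show 40 * n = 2 * (20 * n) by ring]
    refine (meanPotential_two_mul_le hn σ x (20 * n)).trans (ENNReal.ofReal_le_ofReal ?_)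
    have h1 : potential x ≤ n * (101 / 100 : ℝ) ^ n := by
      refine (potential_le x).trans ?_
      gcongr
      · norm_num
      · exact maxLoad_le x
    have h2 : (999 / 1000 : ℝ) ^ (20 * n) * (101 / 100) ^ n ≤ 1 := by
      rw [pow_mul, ← mul_pow]
      exact pow_le_one₀ (by norm_num) (by norm_num)
    calc (999 / 1000 : ℝ) ^ (20 * n) * potential x + 5000 * n
        ≤ (999 / 1000 : ℝ) ^ (20 * n) * (n * (101 / 100 : ℝ) ^ n) + 5000 * n := by gcongr
      _ = n * ((999 / 1000 : ℝ) ^ (20 * n) * (101 / 100) ^ n) + 5000 * n := by ring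
      _ ≤ n * 1 + 5000 * n := by gcongr
      _ = 5001 * (n : ℝ) ^ (1 : ℝ) := by rw [Real.rpow_one]; ring

end Dynamics

theorem theorem1 :
    (∀ c A L γ : ℝ, ∃ K : ℝ, ∀ n : ℕ, 2 ≤ n → ∀ (σ : Strategy n) (x : Config n),
      IsLegitimate L x → ∀ T : ℕ, (T : ℝ) ≤ A * (n : ℝ) ^ c →
        1 - (n : ℝ) ^ (-γ) ≤ runProb σ x T {r | ∀ y ∈ r.configs, IsLegitimate K y}) ∧
    (∀ γ : ℝ, ∃ (K : ℝ) (C : ℕ), ∀ n : ℕ, 2 ≤ n → ∀ (σ : Strategy n) (x : Config n),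
        1 - (n : ℝ) ^ (-γ) ≤ runProb σ x (C * n) {r | ∃ y ∈ r.configs, IsLegitimate K y}) :=
  ⟨stability, convergence⟩
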